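/- Let $p$ be a prime number and let $A$ be a (commutative) local ring whose residue field $k=A/\mathfrak m_A$ has characteristic $p$. Frobenius–Witt differentials. Put $P(X,Y)=\sum_{i=1}^{p-1}\frac{(p-1)!}{i!(p-i)!}X^iY^{p-i}\in\mathbf Z[X,Y]$. For an $A$-module $M$, a map $w\colon A\to M$ is an FW-derivation if $w(a+b)=w(a)+w(b)-P(a,b)\cdot w(p)$ and $w(ab)=b^p\cdot w(a)+a^p\cdot w(b)$ for all $a,b\in A$. Let $w\colon A\to F\Omega^1_A$ be the universal FW-derivation: $F\Omega^1_A$ is the quotient of the free $A$-module on symbols $[a]$ $(a\in A)$ by the submodule generated by all $[a+b]-[a]-[b]+P(a,b)[p]$ and $[ab]-a^p[b]-b^p[a]$, and $w(a)$ is the class of $[a]$. The Gabber–Ramero space. Let $W_2(k)$ be the ring of Witt vectors of length $2$, let $A_2=A\times_kW_2(k)$ be the fibre product over the reduction $A\to k$ and the projection $W_2(k)\to k$, $(x_0,x_1)\mapsto x_0$, and regard $k^{1/p}$ as an $A_2$-algebra through $A_2\to A\to k\subset k^{1/p}$. The kernel of $A_2\to A$ is $V(k)=\{(0,V(x)) :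 x\in k\}$, where $V(x)=(0,x)\in W_2(k)$, and $x\mapsto (0,V(x^p))$ is an isomorphism of $A_2$-modules $k^{1/p}\to V(k)$. Let $\mathbf\Omega_A$ be the $k^{1/p}$-vector space defined as the pushout of $$k^{1/p}\longleftarrow k^{1/p}\otimes_kk^{1/p}\longrightarrow \Omega^1_{A_2/\mathbf Z}\otimes_{A_2}k^{1/p},$$ where the left map is the multiplication and the right map sends $\lambda\otimes x$ to $d(0,V(x^p))\otimes\lambda$. Let $\boldsymbol d_A\colon A\to\mathbf\Omega_A$ send $a$ to the class of $d(a,[\bar a])\otimes 1$, where $\bar a\in k$ is the residue class of $a$ and $[\bar a]=(\bar a,0)\in W_2(k)$ is its Teichmüller representative. Regard $\mathbf\Omega_A$ as a $k$-vector space through the isomorphism $k\to k^{1/p}$, $x\mapsto x^{1/p}$ (under which the inclusion $k\to k^{1/p}$ corresponds to the Frobenius $F\colon k\to k$), and hence as an $A$-module through $A\to k$. Then $\boldsymbol d_A\colon A\to\mathbf\Omega_A$ is an FW-derivation, and the $k$-linear map $$F\Omega^1_A\otimes_Ak\longrightarrow\mathbf\Omega_A,\qquad w(a)\otimes c\mapsto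 c\cdot\boldsymbol d_A(a),$$ induced by $\boldsymbol d_A$ is an isomorphism. -/

import Mathlib

open scoped TensorProduct KaehlerDifferential

universe u v

noncomputable section

/-! ### Frobenius-Witt derivations and Frobenius-Witt differentials -/

section FW

/-- The value `P(a, b)` of the polynomial
`P = ∑_{i=1}^{p-1} ((p-1)! / (i! (p-i)!)) X^i Y^(p-i) ∈ ℤ[X, Y]`
(for `p` prime all the divisions of natural numbers below are exact). -/
def fwPoly (p : ℕ) {A : Type u} [CommRing A] (a b : A) : A :=
  ∑ i ∈ Finset.Icc 1 (p - 1),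
    ((Nat.factorial (p - 1) / (Nat.factorial i * Nat.factorial (p - i)) : ℕ) : A)
      * a ^ i * b ^ (p - i)

/-- `w : A → M` is a Frobenius-Witt derivation. -/
structure IsFWDerivation (p : ℕ) {A : Type u} [CommRing A] {M : Type v} [AddCommGroup M]
    [Module A M] (w : A → M) : Prop where
  map_add : ∀ a b : A, w (a + b) = w a + w b - fwPoly p a b • w (p : A)
  map_mul : ∀ a b : A, w (a * b) = b ^ p • w a + a ^ p • w b

/-- The relations that define the module of FW-differentials. -/
def fwRelations (p : ℕ) (A : Type u) [CommRing A] : Submodule A (A →₀ A) :=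
  Submodule.span A
    ({x | ∃ a b : A, x = Finsupp.single (a + b) 1 - Finsupp.single a 1 - Finsupp.single b 1
          + fwPoly p a b • Finsupp.single (p : A) 1} ∪
     {x | ∃ a b : A, x = Finsupp.single (a * b) 1 - a ^ p • Finsupp.single b 1
          - b ^ p • Finsupp.single a 1})

/-- The module `FΩ¹_A` of FW-differentials of `A`. -/
abbrev FWDifferentials (p : ℕ) (A : Type u) [CommRing A] : Type u :=
  (A →₀ A) ⧸ fwRelations p A

/-- The universal FW-derivation `w : A → FΩ¹_A`. -/
def fwD (p : ℕ) (A : Type u) [CommRing A] (a : A) : FWDifferentials p A :=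
  (fwRelations p A).mkQ (Finsupp.single a 1)

theorem fwD_isFWDerivation (p : ℕ) (A : Type u) [CommRing A] :
    IsFWDerivation p (fwD p A) := by
  constructor
  · intro a b
    have h : (fwRelations p A).mkQ (Finsupp.single (a + b) 1 - Finsupp.single a 1
        - Finsupp.single b 1 + fwPoly p a b • Finsupp.single (p : A) 1) = 0 := by
      rw [Submodule.mkQ_apply, Submodule.Quotient.mk_eq_zero]
      exact Submodule.subset_span (Or.inl ⟨a, b, rfl⟩)
    rw [map_add, map_sub, map_sub, map_smul] at h
    change fwD p A (a + b) - fwD p A a - fwD p A b + fwPoly p a b • fwD p A (p : A) = 0 at h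
    rw [← sub_eq_zero, ← h]
    abel
  · intro a b
    have h : (fwRelations p A).mkQ (Finsupp.single (a * b) 1 - a ^ p • Finsupp.single b 1
        - b ^ p • Finsupp.single a 1) = 0 := by
      rw [Submodule.mkQ_apply, Submodule.Quotient.mk_eq_zero]
      exact Submodule.subset_span (Or.inr ⟨a, b, rfl⟩)
    rw [map_sub, map_sub, map_smul, map_smul] at h
    change fwD p A (a * b) - a ^ p • fwD p A b - b ^ p • fwD p A a = 0 at h
    rw [← sub_eq_zero, ← h]
    abel

/-- The `A`-linear map `FΩ¹_A → M` with `w a ↦ w' a` induced by an FW-derivation `w' : A → M`. -/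
def IsFWDerivation.lift {p : ℕ} {A : Type u} [CommRing A] {M : Type v} [AddCommGroup M]
    [Module A M] {w : A → M} (hw : IsFWDerivation p w) : FWDifferentials p A →ₗ[A] M :=
  (fwRelations p A).liftQ (Finsupp.linearCombination A w) (by
    rw [fwRelations, Submodule.span_le]
    rintro x (⟨a, b, rfl⟩ | ⟨a, b, rfl⟩)
    · simp [hw.map_add a b]
      abel
    · simp [hw.map_mul a b])

theorem IsFWDerivation.lift_fwD {p : ℕ} {A : Type u} [CommRing A] {M : Type v} [AddCommGroup M]
    [Module A M] {w : A → M} (hw : IsFWDerivation p w) (a : A) : hw.lift (fwD p A a) = w a := by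
  simp [IsFWDerivation.lift, fwD]

end FW

/-! ### The field `k^{1/p}` -/

section PthRoot

variable (p : ℕ) [Fact p.Prime] (k : Type u) [Field k] [CharP k p]

/-- The field `k^{1/p}`: the elements of the perfect closure of `k` whose `p`-th power is
in `k`. -/
abbrev PthRootField : Subfield (PerfectClosure k p) :=
  (PerfectClosure.of k p).fieldRange.comap (frobenius (PerfectClosure k p) p)

/-- The inclusion `k → k^{1/p}`. -/
def pthRootIncl : k →+* PthRootField p k :=
  (PerfectClosure.of k p).codRestrict (PthRootField p k) fun x => ⟨x ^ p, by
    rw [map_pow, frobenius_def]⟩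

instance PthRootField.instAlgebra : Algebra k (PthRootField p k) :=
  (pthRootIncl p k).toAlgebra

/-- The isomorphism `k → k^{1/p}`, `x ↦ x^{1/p}`. -/
def pthRoot : k ≃+* PthRootField p k :=
  RingEquiv.ofBijective
    ((((frobeniusEquiv (PerfectClosure k p) p).symm : _ →+* _).comp
      (PerfectClosure.of k p)).codRestrict (PthRootField p k) fun x => ⟨x, by
        change _ = frobenius (PerfectClosure k p) p ((frobeniusEquiv (PerfectClosure k p) p).symm _)
        rw [frobenius_apply_frobeniusEquiv_symm]⟩)
    ⟨RingHom.injective _, by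
      rintro ⟨y, x, hx⟩
      refine ⟨x, Subtype.ext <| frobenius_inj (PerfectClosure k p) p ?_⟩
      refine Eq.trans ?_ hx
      exact frobenius_apply_frobeniusEquiv_symm (PerfectClosure k p) p _⟩

theorem coe_pthRoot_pow (x : k) :
    ((pthRoot p k x : PthRootField p k) : PerfectClosure k p) ^ p = PerfectClosure.of k p x :=
  frobenius_apply_frobeniusEquiv_symm (PerfectClosure k p) p _

/-- Under `k ≃ k^{1/p}`, `x ↦ x^{1/p}`, the inclusion `k → k^{1/p}` becomes the Frobenius. -/
theorem pthRoot_pow (x : k) : pthRoot p k (x ^ p) = pthRootIncl p k x := by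
  apply Subtype.ext
  apply frobenius_inj (PerfectClosure k p) p
  simp only [frobenius_def]
  rw [coe_pthRoot_pow, map_pow]
  rfl

theorem pthRoot_symm_algebraMap (x : k) :
    (pthRoot p k).symm (algebraMap k (PthRootField p k) x) = x ^ p := by
  rw [RingEquiv.symm_apply_eq, pthRoot_pow]
  rfl

end PthRoot

/-! ### Witt vectors of length two -/

section Witt2

variable (p : ℕ) [hp : Fact p.Prime] (k : Type u) [Field k]

/-- The ghost component `ω₀ : W₂(k) → k`, `(x₀, x₁) ↦ x₀`. -/
def witt2Ghost : TruncatedWittVector p 2 k →+* k where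
  toFun x := x.coeff 0
  map_zero' := by simp
  map_one' := by
    rw [← map_one (WittVector.truncate (p := p) (R := k) 2), WittVector.coeff_truncate]
    simp
  map_add' x y := by
    obtain ⟨x, rfl⟩ := WittVector.truncate_surjective p 2 k x
    obtain ⟨y, rfl⟩ := WittVector.truncate_surjective p 2 k y
    rw [← map_add]
    simp only [WittVector.coeff_truncate]
    exact WittVector.add_coeff_zero x y
  map_mul' x y := by
    obtain ⟨x, rfl⟩ := WittVector.truncate_surjective p 2 k x
    obtain ⟨y, rfl⟩ := WittVector.truncate_surjective p 2 k y
    rw [← map_mul]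
    simp only [WittVector.coeff_truncate]
    exact WittVector.mul_coeff_zero x y

/-- The Teichmüller map `k → W₂(k)`, `x ↦ (x, 0)`. -/
def witt2Teichmuller (x : k) : TruncatedWittVector p 2 k :=
  TruncatedWittVector.mk p ![x, 0]

theorem witt2V_aux (x : WittVector p k) :
    TruncatedWittVector.mk p ![0, x.coeff 0] =
      WittVector.truncate 2 (WittVector.verschiebung x) := by
  ext i
  fin_cases i
  · simp [WittVector.coeff_truncate]
  · simp only [TruncatedWittVector.coeff_mk, WittVector.coeff_truncate]
    exact (WittVector.verschiebung_coeff_succ x 0).symm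

/-- The Verschiebung `V : k → W₂(k)`, `x ↦ (0, x)`, whose image is the kernel of `ω₀`. -/
def witt2V : k →+ TruncatedWittVector p 2 k where
  toFun x := TruncatedWittVector.mk p ![0, x]
  map_zero' := by
    ext i
    fin_cases i <;> simp
  map_add' x y := by
    have h := witt2V_aux p k (WittVector.teichmuller p x + WittVector.teichmuller p y)
    rw [map_add, map_add, ← witt2V_aux, ← witt2V_aux] at h
    simpa [WittVector.add_coeff_zero] using h

theorem mul_witt2V [CharP k p] (r : TruncatedWittVector p 2 k) (x : k) :
    r * witt2V p k x = witt2V p k (witt2Ghost p k r ^ p * x) := by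
  obtain ⟨r, rfl⟩ := WittVector.truncate_surjective p 2 k r
  have h := witt2V_aux p k (WittVector.teichmuller p x * WittVector.frobenius r)
  rw [WittVector.verschiebung_mul_frobenius, map_mul, ← witt2V_aux,
    WittVector.mul_coeff_zero, WittVector.coeff_frobenius_charP,
    WittVector.teichmuller_coeff_zero] at h
  rw [mul_comm]
  refine h.symm.trans ?_
  rw [mul_comm]
  rfl

end Witt2

/-! ### The vector space `𝛀_A` and the map `𝒅_A` -/

section GabberRamero

variable (p : ℕ) [Fact p.Prime] (A : Type u) [CommRing A] [IsLocalRing A]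
  [CharP (IsLocalRing.ResidueField A) p]

open IsLocalRing

/-- The ring `A₂ = A ×_k W₂(k)`, where `k` is the residue field of `A`. -/
def GRRing : Subring (A × TruncatedWittVector p 2 (ResidueField A)) :=
  RingHom.eqLocus ((residue A).comp (RingHom.fst _ _))
    ((witt2Ghost p (ResidueField A)).comp (RingHom.snd _ _))

/-- The ring homomorphism `A₂ → A → k`. -/
def grToResidue : GRRing p A →+* ResidueField A :=
  ((residue A).comp (RingHom.fst _ _)).comp (GRRing p A).subtype

/-- `k^{1/p}` as an `A₂`-algebra through `A₂ → A → k → k^{1/p}`. -/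
instance GRRing.instAlgebra : Algebra (GRRing p A) (PthRootField p (ResidueField A)) :=
  ((pthRootIncl p (ResidueField A)).comp (grToResidue p A)).toAlgebra

/-- The multiplicative section `A → A₂`, `a ↦ (a, [ā])`. -/
def grTeichmuller (a : A) : GRRing p A :=
  ⟨(a, witt2Teichmuller p (ResidueField A) (residue A a)), rfl⟩

/-- The isomorphism `x ↦ (0, V(x^p))` from `k^{1/p}` onto the kernel `V(k)` of `A₂ → A`. -/
def grKer : PthRootField p (ResidueField A) →+ GRRing p A where
  toFun x := ⟨(0, witt2V p (ResidueField A) ((pthRoot p (ResidueField A)).symm x)), by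
    change residue A 0 = 0
    exact map_zero _⟩
  map_zero' := Subtype.ext <| Prod.ext rfl <| by
    change witt2V p (ResidueField A) ((pthRoot p (ResidueField A)).symm 0) = 0
    rw [map_zero, map_zero]
  map_add' x y := Subtype.ext <| Prod.ext (add_zero (0 : A)).symm <| by
    change witt2V p (ResidueField A) ((pthRoot p (ResidueField A)).symm (x + y)) =
      witt2V p (ResidueField A) ((pthRoot p (ResidueField A)).symm x) +
      witt2V p (ResidueField A) ((pthRoot p (ResidueField A)).symm y)
    rw [map_add, map_add]

theorem mul_grKer (r : GRRing p A) (x : PthRootField p (ResidueField A)) :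
    r * grKer p A x = grKer p A (algebraMap (ResidueField A) _ (grToResidue p A r) * x) := by
  refine Subtype.ext <| Prod.ext (mul_zero r.1.1) ?_
  change r.1.2 * witt2V p (ResidueField A) _ = witt2V p (ResidueField A) _
  rw [mul_witt2V, RingEquiv.map_mul, pthRoot_symm_algebraMap]
  have h : residue A r.1.1 = witt2Ghost p (ResidueField A) r.1.2 := r.2
  rw [← h]
  rfl

/-- The `k^{1/p}`-vector space `Ω¹_{A₂/ℤ} ⊗_{A₂} k^{1/p}`. -/
abbrev GRKaehler : Type u :=
  PthRootField p (ResidueField A) ⊗[GRRing p A] Ω[GRRing p A⁄ℤ]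

/-- The `k`-linear map `k^{1/p} ≃ V(k) → Ω¹_{A₂/ℤ} ⊗_{A₂} k^{1/p}` of the conormal sequence
of `A₂ → A`. -/
def grConormal : PthRootField p (ResidueField A) →ₗ[ResidueField A] GRKaehler p A where
  toFun x := 1 ⊗ₜ KaehlerDifferential.D ℤ (GRRing p A) (grKer p A x)
  map_add' x y := by rw [map_add, map_add, TensorProduct.tmul_add]
  map_smul' c x := by
    obtain ⟨a, rfl⟩ := residue_surjective c
    have h : grKer p A (residue A a • x) = grTeichmuller p A a * grKer p A x := by
      rw [mul_grKer, Algebra.smul_def]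
      rfl
    have h0 : algebraMap (GRRing p A) (PthRootField p (ResidueField A)) (grKer p A x) = 0 := by
      change pthRootIncl p (ResidueField A) (residue A 0) = 0
      rw [map_zero, map_zero]
    rw [h, Derivation.leibniz, TensorProduct.tmul_add, ← TensorProduct.smul_tmul,
      ← TensorProduct.smul_tmul, Algebra.smul_def (grKer p A x), h0, zero_mul,
      TensorProduct.zero_tmul, add_zero, RingHom.id_apply, TensorProduct.smul_tmul']
    rfl

/-- The `k^{1/p}`-linear map `k^{1/p} ⊗_k V(k) → Ω¹_{A₂/ℤ} ⊗_{A₂} k^{1/p}`, with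
`V(k) ≃ k^{1/p}`. -/
def grConormalExt :
    PthRootField p (ResidueField A) ⊗[ResidueField A] PthRootField p (ResidueField A)
      →ₗ[PthRootField p (ResidueField A)] GRKaehler p A :=
  (grConormal p A).liftBaseChange (PthRootField p (ResidueField A))

/-- The multiplication `k^{1/p} ⊗_k k^{1/p} → k^{1/p}`. -/
def grMult :
    PthRootField p (ResidueField A) ⊗[ResidueField A] PthRootField p (ResidueField A)
      →ₗ[PthRootField p (ResidueField A)] PthRootField p (ResidueField A) :=
  (LinearMap.id (R := ResidueField A) (M := PthRootField p (ResidueField A))).liftBaseChange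
    (PthRootField p (ResidueField A))

/-- The Gabber-Ramero `k^{1/p}`-vector space `𝛀_A`: the pushout of
`k^{1/p} ← k^{1/p} ⊗_k V(k) → Ω¹_{A₂/ℤ} ⊗_{A₂} k^{1/p}`. -/
abbrev GROmega : Type u :=
  (GRKaehler p A × PthRootField p (ResidueField A)) ⧸
    LinearMap.range ((grConormalExt p A).prod (-grMult p A))

/-- `𝛀_A` viewed as a `k`-vector space through the isomorphism `k ≃ k^{1/p}`, `x ↦ x^{1/p}`
(the one that turns the inclusion `k → k^{1/p}` into the Frobenius of `k`). -/
def GROmegaTwist : Type u := GROmega p A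

instance GROmegaTwist.instAddCommGroup : AddCommGroup (GROmegaTwist p A) :=
  inferInstanceAs (AddCommGroup (GROmega p A))

instance GROmegaTwist.instModuleResidueField : Module (ResidueField A) (GROmegaTwist p A) :=
  Module.compHom (GROmega p A) (pthRoot p (ResidueField A)).toRingHom

instance GROmegaTwist.instModule : Module A (GROmegaTwist p A) :=
  Module.compHom (GROmegaTwist p A) (residue A)

instance GROmegaTwist.instIsScalarTower :
    IsScalarTower A (ResidueField A) (GROmegaTwist p A) :=
  IsScalarTower.of_algebraMap_smul fun _ _ => rfl

/-- The map `𝒅_A : A → 𝛀_A`, `a ↦ d(a, [ā])`. -/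
def grD (a : A) : GROmegaTwist p A :=
  (LinearMap.range ((grConormalExt p A).prod (-grMult p A))).mkQ
    (1 ⊗ₜ KaehlerDifferential.D ℤ (GRRing p A) (grTeichmuller p A a), 0)

/-- The `k`-linear map `k ⊗_A FΩ¹_A → M` induced by an FW-derivation from the local ring `A`
to a `k`-vector space `M`. -/
def IsFWDerivation.liftResidue {p : ℕ} {A : Type u} [CommRing A] [IsLocalRing A] {M : Type v}
    [AddCommGroup M] [Module A M] [Module (ResidueField A) M]
    [IsScalarTower A (ResidueField A) M] {w : A → M} (hw : IsFWDerivation p w) :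
    ResidueField A ⊗[A] FWDifferentials p A →ₗ[ResidueField A] M :=
  hw.lift.liftBaseChange (ResidueField A)

end GabberRamero

end

/-!
Write `k` for the residue field of `A`. Two facts about `W₂(k)` carry the argument. First,
`[x + y] = [x] + [y] + V(P(x, y))` (`witt2Teichmuller_add`): the Teichmüller map is multiplicative,
and it fails to be additive by the same polynomial `P` that occurs in the definition of an
FW-derivation. Second, `p = V(1)` because `k` has characteristic `p` (`witt2V_one`).

Every element of `A₂` is `(a, [ā]) + (0, V(y))`, and the pushout that defines `𝛀_A` makes
`d(0, V(y))` equal to `y^{1/p}` times a single vector `e`. Since `p = (p, [0]) + (0, V(1))` in `A₂`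
and `d p = 0`, this vector is `e = -𝒅_A(p)` (`grInr_one`). Differentiating the formulas for
`[a + b]` and `[a b]` then shows that `𝒅_A` is an FW-derivation (`grD_isFWDerivation`), and the
decomposition of the elements of `A₂` shows that the `𝒅_A(a)` span `𝛀_A`
(`GROmegaTwist.eq_top_of_grD_mem`), whence surjectivity.

Conversely, let `w : A → M` be an FW-derivation into a `k`-vector space. The formulas for the sum
and the product of Witt vectors of length two say that `(a, (ā, y)) ↦ w(a) - y w(p)` is a derivation
`A₂ → M` when `A₂` acts on `M` through `a ↦ ā^p` (`IsFWDerivation.grDerivation`). It extends to a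
linear map `𝛀_A → M` with `𝒅_A(a) ↦ w(a)` (`IsFWDerivation.grLiftTwist`). For
`M = k ⊗_A FΩ¹_A` and `w(a) = 1 ⊗ w(a)` this map is a left inverse of the map induced by `𝒅_A`,
whence injectivity.
-/

noncomputable section

/-! ### The polynomial `P` and the coefficients of Witt vectors of length two -/

theorem choose_div_prime_eq {p i : ℕ} (hp : p.Prime) (hi : i ≤ p) :
    p.choose i / p = (p - 1).factorial / (i.factorial * (p - i).factorial) := by
  rw [Nat.choose_eq_factorial_div_factorial hi, Nat.div_div_eq_div_mul, mul_comm _ p,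
    ← Nat.mul_factorial_pred hp.ne_zero, Nat.mul_div_mul_left _ _ hp.pos]

/-- The polynomial `P` measures the failure of `p`-th powers to be additive:
`P = ((X + Y) ^ p - X ^ p - Y ^ p) / p`. -/
theorem add_pow_eq_add_fwPoly {p : ℕ} (hp : p.Prime) {R : Type u} [CommRing R] (a b : R) :
    (a + b) ^ p = a ^ p + b ^ p + p * fwPoly p a b := by
  have hI : Finset.Ioo 0 p = Finset.Icc 1 (p - 1) := by
    ext i
    simp only [Finset.mem_Ioo, Finset.mem_Icc]
    have := hp.pos
    lia
  rw [add_pow_prime_eq' hp, fwPoly, hI]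
  congr 2
  refine Finset.sum_congr rfl fun i hi => ?_
  have hi' : i ≤ p := (Finset.mem_Icc.1 hi).2.trans (Nat.sub_le p 1)
  rw [choose_div_prime_eq hp hi']
  ring

theorem map_fwPoly (p : ℕ) {R : Type u} {S : Type v} [CommRing R] [CommRing S] (f : R →+* S)
    (a b : R) : f (fwPoly p a b) = fwPoly p (f a) (f b) := by
  simp [fwPoly]

theorem fwPoly_zero_right (p : ℕ) {R : Type u} [CommRing R] (a : R) : fwPoly p a 0 = 0 := by
  refine Finset.sum_eq_zero fun i hi => ?_
  have := Finset.mem_Icc.1 hi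
  rw [zero_pow (by lia : p - i ≠ 0), mul_zero]

protected theorem IsFWDerivation.map_zero {p : ℕ} {A : Type u} [CommRing A] {M : Type v}
    [AddCommGroup M] [Module A M] {w : A → M} (hw : IsFWDerivation p w) : w 0 = 0 := by
  have h := hw.map_add 0 0
  rw [fwPoly_zero_right, zero_smul, sub_zero, add_zero] at h
  exact left_eq_add.1 h

section Witt

variable {p : ℕ} [hp : Fact p.Prime] {R : Type u} [CommRing R]

theorem WittVector.ghostComponent_one_apply (x : WittVector p R) :
    WittVector.ghostComponent 1 x = p * x.coeff 1 + x.coeff 0 ^ p := by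
  rw [WittVector.ghostComponent_apply, wittPolynomial_one]
  simp

/-- Every Witt vector over `R` is the image of one over the polynomial ring `ℤ[R]`. As `ℤ[R]` has no
`p`-torsion, identities between Witt vectors may be checked there on ghost components. -/
theorem WittVector.exists_map_mvPolynomial_eq (x : WittVector p R) :
    ∃ y : WittVector p (MvPolynomial R ℤ),
      WittVector.map (MvPolynomial.aeval (R := ℤ) (id : R → R)).toRingHom y = x :=
  WittVector.map_surjective _ (fun r => ⟨MvPolynomial.X r, by simp⟩) x

theorem WittVector.add_coeff_one (x y : WittVector p R) :
    (x + y).coeff 1 = x.coeff 1 + y.coeff 1 - fwPoly p (x.coeff 0) (y.coeff 0) := by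
  obtain ⟨x, rfl⟩ := x.exists_map_mvPolynomial_eq
  obtain ⟨y, rfl⟩ := y.exists_map_mvPolynomial_eq
  rw [← _root_.map_add]
  simp only [WittVector.map_coeff, ← map_fwPoly, ← _root_.map_add, ← map_sub]
  congr 1
  -- The ghost component `p x₁ + x₀ ^ p` is additive, and `p` can be cancelled in `ℤ[R]`.
  have h := _root_.map_add (WittVector.ghostComponent 1) x y
  simp only [WittVector.ghostComponent_one_apply, WittVector.add_coeff_zero,
    add_pow_eq_add_fwPoly hp.out] at h
  refine mul_left_cancel₀ (Nat.cast_ne_zero.2 hp.out.ne_zero) (?_ : (p : MvPolynomial R ℤ) * _ = _)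
  linear_combination h

theorem WittVector.mul_coeff_one (x y : WittVector p R) :
    (x * y).coeff 1 = x.coeff 0 ^ p * y.coeff 1 + y.coeff 0 ^ p * x.coeff 1
      + p * (x.coeff 1 * y.coeff 1) := by
  obtain ⟨x, rfl⟩ := x.exists_map_mvPolynomial_eq
  obtain ⟨y, rfl⟩ := y.exists_map_mvPolynomial_eq
  rw [← _root_.map_mul]
  simp only [WittVector.map_coeff]
  rw [← map_natCast (MvPolynomial.aeval (R := ℤ) (id : R → R)).toRingHom p]
  simp only [← _root_.map_add, ← _root_.map_mul, ← map_pow]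
  congr 1
  -- The ghost component `p x₁ + x₀ ^ p` is multiplicative, and `p` can be cancelled in `ℤ[R]`.
  have h := _root_.map_mul (WittVector.ghostComponent 1) x y
  simp only [WittVector.ghostComponent_one_apply, WittVector.mul_coeff_zero] at h
  refine mul_left_cancel₀ (Nat.cast_ne_zero.2 hp.out.ne_zero) (?_ : (p : MvPolynomial R ℤ) * _ = _)
  linear_combination h

end Witt

section Witt2

variable {p : ℕ} {k : Type u}

theorem witt2_ext {x y : TruncatedWittVector p 2 k} (h0 : x.coeff 0 = y.coeff 0)
    (h1 : x.coeff 1 = y.coeff 1) : x = y := by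
  ext i
  fin_cases i
  exacts [h0, h1]

variable [Field k]

@[simp] theorem witt2Teichmuller_coeff_zero (x : k) : (witt2Teichmuller p k x).coeff 0 = x := by
  simp [witt2Teichmuller]

@[simp] theorem witt2Teichmuller_coeff_one (x : k) : (witt2Teichmuller p k x).coeff 1 = 0 := by
  simp [witt2Teichmuller]

variable [hp : Fact p.Prime]

theorem witt2_add_coeff_zero (x y : TruncatedWittVector p 2 k) :
    (x + y).coeff 0 = x.coeff 0 + y.coeff 0 :=
  map_add (witt2Ghost p k) x y

theorem witt2_mul_coeff_zero (x y : TruncatedWittVector p 2 k) :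
    (x * y).coeff 0 = x.coeff 0 * y.coeff 0 :=
  map_mul (witt2Ghost p k) x y

theorem witt2_add_coeff_one (x y : TruncatedWittVector p 2 k) :
    (x + y).coeff 1 = x.coeff 1 + y.coeff 1 - fwPoly p (x.coeff 0) (y.coeff 0) := by
  obtain ⟨x, rfl⟩ := WittVector.truncate_surjective p 2 k x
  obtain ⟨y, rfl⟩ := WittVector.truncate_surjective p 2 k y
  rw [← map_add]
  simp only [WittVector.coeff_truncate]
  exact x.add_coeff_one y

theorem witt2_mul_coeff_one [CharP k p] (x y : TruncatedWittVector p 2 k) :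
    (x * y).coeff 1 = x.coeff 0 ^ p * y.coeff 1 + y.coeff 0 ^ p * x.coeff 1 := by
  obtain ⟨x, rfl⟩ := WittVector.truncate_surjective p 2 k x
  obtain ⟨y, rfl⟩ := WittVector.truncate_surjective p 2 k y
  rw [← map_mul]
  simp only [WittVector.coeff_truncate]
  have h := x.mul_coeff_one y
  rw [CharP.cast_eq_zero, zero_mul, add_zero] at h
  exact h

@[simp] theorem witt2V_coeff_zero (x : k) : (witt2V p k x).coeff 0 = 0 := by
  simp [witt2V]

@[simp] theorem witt2V_coeff_one (x : k) : (witt2V p k x).coeff 1 = x := by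
  simp [witt2V]

theorem witt2Teichmuller_mul [CharP k p] (x y : k) :
    witt2Teichmuller p k (x * y) = witt2Teichmuller p k x * witt2Teichmuller p k y := by
  apply witt2_ext
  · simp [witt2_mul_coeff_zero]
  · simp [witt2_mul_coeff_one]

/-- `(x₀, x₁) = [x₀] + V(x₁)`. -/
theorem witt2Teichmuller_add_witt2V (x : TruncatedWittVector p 2 k) :
    witt2Teichmuller p k (x.coeff 0) + witt2V p k (x.coeff 1) = x := by
  apply witt2_ext
  · simp [witt2_add_coeff_zero]
  · simp [witt2_add_coeff_one, fwPoly_zero_right]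

/-- The Teichmüller map fails to be additive by exactly the polynomial `P` that enters in the
definition of an FW-derivation. -/
theorem witt2Teichmuller_add (x y : k) :
    witt2Teichmuller p k (x + y) =
      witt2Teichmuller p k x + witt2Teichmuller p k y + witt2V p k (fwPoly p x y) := by
  apply witt2_ext
  · simp [witt2_add_coeff_zero]
  · simp [witt2_add_coeff_one, witt2_add_coeff_zero, fwPoly_zero_right]

/-- In characteristic `p` one has `p = V(F(1)) = V(1)`. -/
theorem witt2V_one [CharP k p] : witt2V p k 1 = p := by
  rw [← map_natCast (WittVector.truncate (p := p) (R := k) 2) p]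
  apply witt2_ext
  · rw [WittVector.coeff_truncate, witt2V_coeff_zero]
    exact (WittVector.coeff_p (R := k) (p := p) 0).symm
  · rw [WittVector.coeff_truncate, witt2V_coeff_one]
    exact (WittVector.coeff_p_one (R := k) (p := p)).symm

end Witt2

/-! ### The map `𝒅_A` is a Frobenius-Witt derivation -/

open IsLocalRing

section GabberRamero

variable (p : ℕ) [Fact p.Prime] (A : Type u) [CommRing A] [IsLocalRing A]
  [CharP (ResidueField A) p]

/-- The structure map `Ω¹_{A₂/ℤ} ⊗_{A₂} k^{1/p} → 𝛀_A` of the pushout. -/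
def grInl : GRKaehler p A →ₗ[PthRootField p (ResidueField A)] GROmega p A :=
  (LinearMap.range ((grConormalExt p A).prod (-grMult p A))).mkQ ∘ₗ LinearMap.inl _ _ _

/-- The structure map `k^{1/p} → 𝛀_A` of the pushout. -/
def grInr : PthRootField p (ResidueField A) →ₗ[PthRootField p (ResidueField A)] GROmega p A :=
  (LinearMap.range ((grConormalExt p A).prod (-grMult p A))).mkQ ∘ₗ LinearMap.inr _ _ _

/-- The composite of the universal derivation of `A₂` with `Ω¹_{A₂/ℤ} → 𝛀_A`. -/
def grDerivative (r : GRRing p A) : GROmega p A :=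
  grInl p A (1 ⊗ₜ KaehlerDifferential.D ℤ (GRRing p A) r)

variable {A}

theorem grDerivative_add (r s : GRRing p A) :
    grDerivative p A (r + s) = grDerivative p A r + grDerivative p A s := by
  simp only [grDerivative, map_add, TensorProduct.tmul_add]

theorem grDerivative_mul (r s : GRRing p A) :
    grDerivative p A (r * s) =
      algebraMap (GRRing p A) (PthRootField p (ResidueField A)) r • grDerivative p A s +
      algebraMap (GRRing p A) (PthRootField p (ResidueField A)) s • grDerivative p A r := by
  simp only [grDerivative, Derivation.leibniz, TensorProduct.tmul_add, map_add, ← map_smul,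
    ← TensorProduct.smul_tmul, TensorProduct.smul_tmul', Algebra.smul_def,
    Algebra.algebraMap_self, RingHom.id_apply]

theorem grDerivative_natCast (n : ℕ) : grDerivative p A n = 0 := by
  rw [grDerivative, Derivation.map_natCast, TensorProduct.tmul_zero, map_zero]

/-- The pushout relation: the class of `d(0, V(x^p))` is the image of `x` under the
structure map `k^{1/p} → 𝛀_A`. -/
theorem grDerivative_grKer (x : PthRootField p (ResidueField A)) :
    grDerivative p A (grKer p A x) = grInr p A x := by
  refine (Submodule.Quotient.eq _).2 ⟨1 ⊗ₜ x, ?_⟩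
  refine Prod.ext ?_ ?_
  · change (1 : PthRootField p (ResidueField A)) • grConormal p A x = _ - 0
    rw [one_smul, sub_zero]
    rfl
  · change -((1 : PthRootField p (ResidueField A)) • x) = 0 - x
    rw [one_smul, zero_sub]

theorem grInr_eq_smul (x : PthRootField p (ResidueField A)) :
    grInr p A x = x • grInr p A 1 := by
  rw [← map_smul, smul_eq_mul, mul_one]

/-- Every `(a, (ā, y)) ∈ A₂` is `(a, [ā]) + (0, V(y))`. -/
theorem GRRing.eq_grTeichmuller_add_grKer (r : GRRing p A) :
    r = grTeichmuller p A r.1.1 +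
      grKer p A (pthRoot p (ResidueField A) (r.1.2.coeff 1)) := by
  refine Subtype.ext <| Prod.ext (add_zero r.1.1).symm ?_
  have h : residue A r.1.1 = r.1.2.coeff 0 := r.2
  change r.1.2 = witt2Teichmuller p _ (residue A r.1.1) +
    witt2V p _ ((pthRoot p (ResidueField A)).symm (pthRoot p (ResidueField A) (r.1.2.coeff 1)))
  rw [RingEquiv.symm_apply_apply, h, witt2Teichmuller_add_witt2V]

theorem grTeichmuller_mul (a b : A) :
    grTeichmuller p A (a * b) = grTeichmuller p A a * grTeichmuller p A b := by
  refine Subtype.ext <| Prod.ext rfl ?_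
  change witt2Teichmuller p _ (residue A (a * b)) =
    witt2Teichmuller p _ (residue A a) * witt2Teichmuller p _ (residue A b)
  rw [map_mul, witt2Teichmuller_mul]

theorem grTeichmuller_add (a b : A) :
    grTeichmuller p A (a + b) = grTeichmuller p A a + grTeichmuller p A b +
      grKer p A (pthRoot p (ResidueField A) (residue A (fwPoly p a b))) := by
  refine Subtype.ext <| Prod.ext (add_zero (a + b)).symm ?_
  change witt2Teichmuller p _ (residue A (a + b)) =
    witt2Teichmuller p _ (residue A a) + witt2Teichmuller p _ (residue A b) +
      witt2V p _ ((pthRoot p (ResidueField A)).symm (pthRoot p (ResidueField A) _))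
  rw [map_add, RingEquiv.symm_apply_apply, map_fwPoly, witt2Teichmuller_add]

variable (A) in
/-- In `A₂ = A ×_k W₂(k)` one has `p = (p, V(1)) = (p, [0]) + (0, V(1))`. -/
theorem grTeichmuller_natCast_add_grKer_one :
    grTeichmuller p A (p : A) + grKer p A 1 = p := by
  have h : (p : GRRing p A).1.2 = p := map_natCast ((RingHom.snd _ _).comp (GRRing p A).subtype) p
  have h' : (p : GRRing p A).1.1 = p := map_natCast ((RingHom.fst _ _).comp (GRRing p A).subtype) p
  have hp := GRRing.eq_grTeichmuller_add_grKer p (p : GRRing p A)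
  rw [h, h', ← witt2V_one, witt2V_coeff_one, map_one] at hp
  exact hp.symm

variable (A) in
/-- In `𝛀_A` the class of `(0, V(1))` is `-𝒅_A(p)`, because `p = (0, 1) = V(1)` in `W₂(k)`. -/
theorem grInr_one : grInr p A 1 = -grDerivative p A (grTeichmuller p A (p : A)) := by
  rw [eq_neg_iff_add_eq_zero, add_comm, ← grDerivative_grKer, ← grDerivative_add,
    grTeichmuller_natCast_add_grKer_one, grDerivative_natCast]

variable (A) in
theorem grD_isFWDerivation : IsFWDerivation p (grD p A) := by
  constructor
  · intro a b
    change grDerivative p A (grTeichmuller p A (a + b)) =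
      grDerivative p A (grTeichmuller p A a) + grDerivative p A (grTeichmuller p A b) -
        pthRoot p (ResidueField A) (residue A (fwPoly p a b)) •
          grDerivative p A (grTeichmuller p A (p : A))
    rw [grTeichmuller_add, grDerivative_add, grDerivative_add, grDerivative_grKer, grInr_eq_smul,
      grInr_one, smul_neg, ← sub_eq_add_neg]
  · intro a b
    change grDerivative p A (grTeichmuller p A (a * b)) =
      pthRoot p (ResidueField A) (residue A (b ^ p)) • grDerivative p A (grTeichmuller p A a) +
        pthRoot p (ResidueField A) (residue A (a ^ p)) • grDerivative p A (grTeichmuller p A b)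
    rw [grTeichmuller_mul, grDerivative_mul, add_comm, map_pow (residue A), map_pow (residue A),
      pthRoot_pow, pthRoot_pow]
    rfl

/-! ### Generators of `𝛀_A` -/

variable (A) in
theorem span_range_one_tmul_D :
    Submodule.span (PthRootField p (ResidueField A))
      (Set.range fun r => (1 ⊗ₜ KaehlerDifferential.D ℤ (GRRing p A) r : GRKaehler p A)) = ⊤ := by
  have h := Submodule.baseChange_span (R := GRRing p A)
    (A := PthRootField p (ResidueField A)) (Set.range (KaehlerDifferential.D ℤ (GRRing p A)))
  rw [KaehlerDifferential.span_range_derivation, Submodule.baseChange_top, ← Set.range_comp] at h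
  exact h.symm

theorem grInl_mem {S : Submodule (PthRootField p (ResidueField A)) (GROmega p A)}
    (hS : ∀ r, grDerivative p A r ∈ S) (t : GRKaehler p A) : grInl p A t ∈ S := by
  have h : ⊤ ≤ S.comap (grInl p A) := by
    rw [← span_range_one_tmul_D, Submodule.span_le]
    rintro _ ⟨r, rfl⟩
    exact hS r
  exact h Submodule.mem_top

/-- The elements `𝒅_A(a)` span `𝛀_A` over `k^{1/p}`, since `A₂` is generated as a group by the
`(a, [ā])` and the `(0, V(y))`, and `d(0, V(y))` is a multiple of `𝒅_A(p)`. -/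
theorem eq_top_of_grDerivative_grTeichmuller_mem
    {S : Submodule (PthRootField p (ResidueField A)) (GROmega p A)}
    (hS : ∀ a, grDerivative p A (grTeichmuller p A a) ∈ S) : S = ⊤ := by
  have hr (x : PthRootField p (ResidueField A)) : grInr p A x ∈ S := by
    rw [grInr_eq_smul, grInr_one]
    exact S.smul_mem x (S.neg_mem (hS p))
  have hD (r : GRRing p A) : grDerivative p A r ∈ S := by
    rw [GRRing.eq_grTeichmuller_add_grKer p r, grDerivative_add, grDerivative_grKer]
    exact S.add_mem (hS _) (hr _)
  refine eq_top_iff.2 fun x _ => ?_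
  obtain ⟨⟨t, y⟩, rfl⟩ := Submodule.mkQ_surjective _ x
  have hty : ((t, y) : GRKaehler p A × PthRootField p (ResidueField A)) = (t, 0) + (0, y) := by
    rw [Prod.mk_add_mk, add_zero, zero_add]
  rw [hty, map_add]
  exact S.add_mem (grInl_mem p hD t) (hr y)

/-- A `k`-subspace of the twist of `𝛀_A`, regarded as a `k^{1/p}`-subspace of `𝛀_A`. -/
def GROmegaTwist.untwistSubmodule (S : Submodule (ResidueField A) (GROmegaTwist p A)) :
    Submodule (PthRootField p (ResidueField A)) (GROmega p A) where
  carrier := S.carrier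
  add_mem' := S.add_mem'
  zero_mem' := S.zero_mem'
  smul_mem' c x hx := by
    obtain ⟨c, rfl⟩ := (pthRoot p (ResidueField A)).surjective c
    exact S.smul_mem c hx

theorem GROmegaTwist.eq_top_of_grD_mem {S : Submodule (ResidueField A) (GROmegaTwist p A)}
    (hS : ∀ a, grD p A a ∈ S) : S = ⊤ := by
  have h := eq_top_of_grDerivative_grTeichmuller_mem p (S := untwistSubmodule p S) hS
  exact Submodule.eq_top_iff'.2 fun x => Submodule.eq_top_iff'.1 h x

end GabberRamero

/-! ### The universal property of `𝒅_A` -/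

/-- A `k`-vector space `M` viewed as a `k^{1/p}`-vector space through the isomorphism
`k^{1/p} ≃ k`, `x ↦ x^p`; the inverse of the passage from `𝛀_A` to `GROmegaTwist`. -/
def PthRootTwist (p : ℕ) (k : Type u) (M : Type v) [Fact p.Prime] [Field k] [CharP k p] : Type v :=
  M

section PthRootTwist

variable (p : ℕ) [Fact p.Prime] (k : Type u) [Field k] [CharP k p]
  (M : Type v) [AddCommGroup M] [Module k M]

instance PthRootTwist.instAddCommGroup : AddCommGroup (PthRootTwist p k M) :=
  inferInstanceAs (AddCommGroup M)

instance PthRootTwist.instModule : Module (PthRootField p k) (PthRootTwist p k M) :=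
  Module.compHom M (pthRoot p k).symm.toRingHom

variable {M}

/-- The identity `M → M` onto the twisted vector space. -/
def PthRootTwist.of : M ≃+ PthRootTwist p k M := AddEquiv.refl M

theorem PthRootTwist.smul_of (c : PthRootField p k) (m : M) :
    c • PthRootTwist.of p k m = PthRootTwist.of p k ((pthRoot p k).symm c • m) := rfl

end PthRootTwist

section Lift

variable {p : ℕ} [Fact p.Prime] {A : Type u} [CommRing A] [IsLocalRing A]
  [CharP (ResidueField A) p]

/-- The ring `A₂` acts on a twisted `k`-vector space through `A₂ → k^{1/p}`. -/
instance PthRootTwist.instModuleGRRing (M : Type v) [AddCommGroup M] [Module (ResidueField A) M] :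
    Module (GRRing p A) (PthRootTwist p (ResidueField A) M) :=
  Module.compHom _ (algebraMap (GRRing p A) (PthRootField p (ResidueField A)))

instance PthRootTwist.instIsScalarTower (M : Type v) [AddCommGroup M]
    [Module (ResidueField A) M] :
    IsScalarTower (GRRing p A) (PthRootField p (ResidueField A))
      (PthRootTwist p (ResidueField A) M) :=
  IsScalarTower.of_algebraMap_smul fun _ _ => rfl

variable {M : Type v} [AddCommGroup M] [Module A M] [Module (ResidueField A) M]
  [IsScalarTower A (ResidueField A) M]

theorem PthRootTwist.grRing_smul_of (r : GRRing p A) (m : M) :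
    r • PthRootTwist.of p (ResidueField A) m =
      PthRootTwist.of p (ResidueField A) (r.1.1 ^ p • m) := by
  rw [← algebraMap_smul (ResidueField A) (r.1.1 ^ p) m, ResidueField.algebraMap_eq, map_pow,
    ← pthRoot_symm_algebraMap]
  rfl

variable {w : A → M}

/-- The additive map `A₂ → M`, `(a, (ā, y)) ↦ w(a) - y w(p)`, attached to an FW-derivation
`w : A → M`; it is additive because `P` is also the correction term in the sum of Witt vectors. -/
def IsFWDerivation.grAddMonoidHom (hw : IsFWDerivation p w) : GRRing p A →+ M :=
  AddMonoidHom.mk' (fun r => w r.1.1 - r.1.2.coeff 1 • w (p : A)) fun r s => by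
    have hr : residue A r.1.1 = r.1.2.coeff 0 := r.2
    have hs : residue A s.1.1 = s.1.2.coeff 0 := s.2
    change w (r.1.1 + s.1.1) - (r.1.2 + s.1.2).coeff 1 • w (p : A) =
      (w r.1.1 - r.1.2.coeff 1 • w (p : A)) + (w s.1.1 - s.1.2.coeff 1 • w (p : A))
    rw [hw.map_add, witt2_add_coeff_one, ← hr, ← hs, ← map_fwPoly,
      ← algebraMap_smul (ResidueField A) (fwPoly p r.1.1 s.1.1), ResidueField.algebraMap_eq,
      sub_smul, add_smul]
    abel

/-- The derivation `A₂ → M`, `(a, (ā, y)) ↦ w(a) - y w(p)`, attached to an FW-derivation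
`w : A → M`. -/
def IsFWDerivation.grDerivation (hw : IsFWDerivation p w) :
    Derivation ℤ (GRRing p A) (PthRootTwist p (ResidueField A) M) :=
  Derivation.mk' ((PthRootTwist.of p (ResidueField A)).toAddMonoidHom.comp
    hw.grAddMonoidHom).toIntLinearMap fun r s => by
    have hr : residue A r.1.1 = r.1.2.coeff 0 := r.2
    have hs : residue A s.1.1 = s.1.2.coeff 0 := s.2
    change PthRootTwist.of p (ResidueField A)
        (w (r.1.1 * s.1.1) - (r.1.2 * s.1.2).coeff 1 • w (p : A)) =
      r • PthRootTwist.of p (ResidueField A) (w s.1.1 - s.1.2.coeff 1 • w (p : A)) +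
        s • PthRootTwist.of p (ResidueField A) (w r.1.1 - r.1.2.coeff 1 • w (p : A))
    rw [PthRootTwist.grRing_smul_of, PthRootTwist.grRing_smul_of, ← _root_.map_add]
    congr 1
    rw [hw.map_mul, witt2_mul_coeff_one, ← hr, ← hs, ← map_pow, ← map_pow]
    simp only [← algebraMap_smul (ResidueField A) (_ ^ p : A) (_ : M), ResidueField.algebraMap_eq,
      smul_sub, add_smul, mul_smul]
    abel

theorem IsFWDerivation.grDerivation_grTeichmuller (hw : IsFWDerivation p w) (a : A) :
    hw.grDerivation (grTeichmuller p A a) = PthRootTwist.of p (ResidueField A) (w a) := by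
  change PthRootTwist.of p (ResidueField A)
    (w a - (witt2Teichmuller p (ResidueField A) (residue A a)).coeff 1 • w (p : A)) = _
  rw [witt2Teichmuller_coeff_one, zero_smul, sub_zero]

theorem IsFWDerivation.grDerivation_grKer (hw : IsFWDerivation p w)
    (x : PthRootField p (ResidueField A)) :
    hw.grDerivation (grKer p A x) = -(x • PthRootTwist.of p (ResidueField A) (w (p : A))) := by
  change PthRootTwist.of p (ResidueField A)
    (w 0 - (witt2V p _ ((pthRoot p (ResidueField A)).symm x)).coeff 1 • w (p : A)) = _
  rw [hw.map_zero, witt2V_coeff_one, zero_sub, map_neg, PthRootTwist.smul_of]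

/-- The `k^{1/p}`-linear map `Ω¹_{A₂/ℤ} ⊗_{A₂} k^{1/p} → M` induced by the derivation
`(a, (ā, y)) ↦ w(a) - y w(p)`. -/
def IsFWDerivation.grKaehlerLift (hw : IsFWDerivation p w) :
    GRKaehler p A →ₗ[PthRootField p (ResidueField A)] PthRootTwist p (ResidueField A) M :=
  hw.grDerivation.liftKaehlerDifferential.liftBaseChange (PthRootField p (ResidueField A))

theorem IsFWDerivation.grKaehlerLift_one_tmul (hw : IsFWDerivation p w) (r : GRRing p A) :
    hw.grKaehlerLift (1 ⊗ₜ KaehlerDifferential.D ℤ (GRRing p A) r) = hw.grDerivation r := by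
  rw [IsFWDerivation.grKaehlerLift, LinearMap.liftBaseChange_tmul, one_smul,
    Derivation.liftKaehlerDifferential_comp_D]

/-- The `k^{1/p}`-linear map `𝛀_A → M` with `𝒅_A(a) ↦ w(a)` induced by an FW-derivation
`w : A → M`. On the summand `Ω¹_{A₂/ℤ} ⊗_{A₂} k^{1/p}` of the pushout it is induced by the
derivation `(a, (ā, y)) ↦ w(a) - y w(p)`, on the summand `k^{1/p}` by `1 ↦ -w(p)`. -/
def IsFWDerivation.grLift (hw : IsFWDerivation p w) :
    GROmega p A →ₗ[PthRootField p (ResidueField A)] PthRootTwist p (ResidueField A) M :=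
  (LinearMap.range ((grConormalExt p A).prod (-grMult p A))).liftQ
    (LinearMap.coprod hw.grKaehlerLift (LinearMap.toSpanSingleton _ _
      (-PthRootTwist.of p (ResidueField A) (w (p : A))))) (by
    refine LinearMap.range_le_ker_iff.2 (LinearMap.ext fun t => ?_)
    induction t using TensorProduct.induction_on with
    | zero => rw [_root_.map_zero, _root_.map_zero]
    | add t u ht hu => rw [_root_.map_add, ht, hu, _root_.map_add]
    | tmul l x => ?_
    change hw.grKaehlerLift (l • (1 ⊗ₜ KaehlerDifferential.D ℤ (GRRing p A) (grKer p A x))) +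
      -(l • x) • -PthRootTwist.of p (ResidueField A) (w (p : A)) = 0
    rw [map_smul, hw.grKaehlerLift_one_tmul, hw.grDerivation_grKer, smul_eq_mul, neg_smul_neg,
      smul_neg, mul_smul, neg_add_cancel])

theorem IsFWDerivation.grLift_grD (hw : IsFWDerivation p w) (a : A) :
    hw.grLift (grD p A a) = PthRootTwist.of p (ResidueField A) (w a) := by
  change hw.grKaehlerLift (1 ⊗ₜ KaehlerDifferential.D ℤ (GRRing p A) (grTeichmuller p A a)) +
    (0 : PthRootField p (ResidueField A)) •
      -PthRootTwist.of p (ResidueField A) (w (p : A)) = _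
  rw [hw.grKaehlerLift_one_tmul, hw.grDerivation_grTeichmuller, zero_smul, add_zero]

/-- The map `𝛀_A → M` induced by an FW-derivation `w : A → M`, as a `k`-linear map on the twist
of `𝛀_A`. -/
def IsFWDerivation.grLiftTwist (hw : IsFWDerivation p w) :
    GROmegaTwist p A →ₗ[ResidueField A] M where
  toFun x := (PthRootTwist.of p (ResidueField A)).symm (hw.grLift x)
  map_add' x y := by
    refine Eq.trans ?_ (_root_.map_add (PthRootTwist.of p (ResidueField A)).symm _ _)
    exact congrArg _ (hw.grLift.map_add x y)
  map_smul' c x := by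
    refine (congrArg (PthRootTwist.of p (ResidueField A)).symm
      (hw.grLift.map_smul (pthRoot p (ResidueField A) c) x)).trans ?_
    obtain ⟨m, hm⟩ := (PthRootTwist.of p (ResidueField A)).surjective (hw.grLift x)
    rw [← hm, PthRootTwist.smul_of, RingEquiv.symm_apply_apply, AddEquiv.symm_apply_apply,
      AddEquiv.symm_apply_apply, RingHom.id_apply]

theorem IsFWDerivation.grLiftTwist_grD (hw : IsFWDerivation p w) (a : A) :
    hw.grLiftTwist (grD p A a) = w a :=
  congrArg (PthRootTwist.of p (ResidueField A)).symm (hw.grLift_grD a)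

end Lift

/-! ### The isomorphism -/

theorem fwD_hom_ext {p : ℕ} {A : Type u} [CommRing A] {M : Type v} [AddCommGroup M] [Module A M]
    {f g : FWDifferentials p A →ₗ[A] M} (h : ∀ a, f (fwD p A a) = g (fwD p A a)) : f = g := by
  exact Submodule.linearMap_qext _ (Finsupp.lhom_ext' fun a => LinearMap.ext_ring (h a))

/-- The FW-derivation `A → k ⊗_A FΩ¹_A`, `a ↦ 1 ⊗ w(a)`. -/
theorem one_tmul_fwD_isFWDerivation (p : ℕ) (A : Type u) [CommRing A] [IsLocalRing A] :
    IsFWDerivation p (fun a : A => ((1 : ResidueField A) ⊗ₜ[A] fwD p A a)) where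
  map_add a b := by
    rw [(fwD_isFWDerivation p A).map_add, TensorProduct.tmul_sub, TensorProduct.tmul_add,
      TensorProduct.tmul_smul]
  map_mul a b := by
    rw [(fwD_isFWDerivation p A).map_mul, TensorProduct.tmul_add, TensorProduct.tmul_smul,
      TensorProduct.tmul_smul]

end

theorem mainTheorem4 (p : ℕ) [Fact p.Prime] (A : Type u) [CommRing A] [IsLocalRing A]
    [CharP (IsLocalRing.ResidueField A) p] :
    ∃ h : IsFWDerivation p (grD p A), Function.Bijective h.liftResidue := by
  have h := grD_isFWDerivation p A
  have hval (a : A) : h.liftResidue (1 ⊗ₜ fwD p A a) = grD p A a := by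
    rw [IsFWDerivation.liftResidue, LinearMap.liftBaseChange_tmul, one_smul,
      IsFWDerivation.lift_fwD]
  refine ⟨h, ?_, ?_⟩
  · let g := (one_tmul_fwD_isFWDerivation p A).grLiftTwist
    have hg : g ∘ₗ h.liftResidue = LinearMap.id := by
      refine TensorProduct.AlgebraTensorModule.curry_injective (LinearMap.ext_ring ?_)
      refine fwD_hom_ext fun a => ?_
      change g (h.liftResidue (1 ⊗ₜ fwD p A a)) = 1 ⊗ₜ fwD p A a
      rw [hval]
      exact (one_tmul_fwD_isFWDerivation p A).grLiftTwist_grD a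
    exact Function.LeftInverse.injective (LinearMap.congr_fun hg)
  · exact LinearMap.range_eq_top.1 <|
      GROmegaTwist.eq_top_of_grD_mem p fun a => ⟨1 ⊗ₜ fwD p A a, hval a⟩
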